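/- Let $\mathbb Z_+=\{0,1,2,\dots\}$. A set $A\subseteq\mathbb Z_+$ is relatively dense if there is an integer $l>0$ such that $\{a,a+1,\dots,a+l\}\cap A\neq\emptyset$ for all $a\in\mathbb Z_+$. A sequence $\varphi:\mathbb Z_+\to\mathbb R$ is called *remotely $\tau$-periodic* ($\tau\in\mathbb Z_+$) if $\lim_{n\to+\infty}|\varphi(n+\tau)-\varphi(n)|=0$; *remotely stationary* if it is remotely $\tau$-periodic for every $\tau\in\mathbb Z_+$; *remotely almost periodic* if for every $\varepsilon>0$ there is a relatively dense set $P\subseteq\mathbb Z_+$ such that for every $\tau\in P$ there is $L>0$ with $|\varphi(n+\tau)-\varphi(n)|<\varepsilon$ for all $n\ge L$. **Theorem.** Let $\mu>0$, $0<\alpha<\beta$, and let $K:\mathbb Z_+\to\mathbb R$ satisfy $\alpha\le K_n\le\beta$ for all $n\in\mathbb Z_+$. Assume $\mu\beta^2\alpha^{-2}\le 1$. Suppose that $K$ is remotely stationary (respectively remotely $\tau$-periodic for a given integer $\tau>0$, or remotely almost periodic). Then every solution of the Beverton–Holt equation $$x_{n+1}=\frac{\mu K_nx_n}{K_n+(\mu-1)x_n},\qquad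 n\in\mathbb Z_+,$$ that is, every real sequence $(x_n)_{n\in\mathbb Z_+}$ for which $K_n+(\mu-1)x_n\ne0$ and the equation holds for every $n\in\mathbb Z_+$, is remotely stationary (respectively remotely $\tau$-periodic with the same $\tau$, or remotely almost periodic). -/

import Mathlib

namespace BevertonHolt

/-- A set `A ⊆ ℤ₊` is relatively dense if for some positive integer `l` every segment
`[a, a + l]`, `a ∈ ℤ₊`, meets `A`. -/
def RelativelyDense (A : Set ℕ) : Prop :=
  ∃ l : ℕ, 0 < l ∧ ∀ a : ℕ, (Set.Icc a (a + l) ∩ A).Nonempty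

/-- A sequence `φ : ℤ₊ → ℝ` is remotely `τ`-periodic if `|φ (n + τ) - φ n| → 0`
as `n → +∞`. -/
def RemotelyPeriodic (τ : ℕ) (φ : ℕ → ℝ) : Prop :=
  Filter.Tendsto (fun n : ℕ => |φ (n + τ) - φ n|) Filter.atTop (nhds 0)

/-- A sequence is remotely stationary if it is remotely `τ`-periodic for every `τ ∈ ℤ₊`. -/
def RemotelyStationary (φ : ℕ → ℝ) : Prop :=
  ∀ τ : ℕ, RemotelyPeriodic τ φ

/-- A sequence is remotely almost periodic if for every `ε > 0` there is a relatively dense set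
of `τ ∈ ℤ₊` such that `|φ (n + τ) - φ n| < ε` for all `n` beyond some `L = L(ε, τ)`. -/
def RemotelyAlmostPeriodic (φ : ℕ → ℝ) : Prop :=
  ∀ ε : ℝ, 0 < ε → ∃ P : Set ℕ, RelativelyDense P ∧
    ∀ τ ∈ P, ∃ L : ℕ, 0 < L ∧ ∀ n : ℕ, L ≤ n → |φ (n + τ) - φ n| < ε

/-- `x : ℤ₊ → ℝ` is a solution of the Beverton–Holt equation
`x (n + 1) = μ K n x n / (K n + (μ - 1) x n)`: at every step the right-hand side is defined
(its denominator does not vanish) and the equation holds. -/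
def IsSolution (μ : ℝ) (K x : ℕ → ℝ) : Prop :=
  ∀ n : ℕ, K n + (μ - 1) * x n ≠ 0 ∧
    x (n + 1) = μ * K n * x n / (K n + (μ - 1) * x n)

end BevertonHolt

namespace BevertonHolt

open Filter Topology

/-! The reciprocal `y = 1/x` linearizes the equation to `y n = μ * y (n + 1) + (1 - μ) / K n`, and
the hypotheses force `μ < 1`, so this contracts backward in time. A nonzero solution therefore
either has `|y| → ∞`, so that `x → 0`, or has `y` in `[1/β, 1/α]`. In the second case shift
differences of `y` satisfy the same recurrence, forced by those of `1/K`, so a tail bound on the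
forcing passes to `y` with the same threshold and, as `0 < x ≤ β`, to `x`. -/

/-- A sequence bounded above and satisfying a backward contraction inequality from `L` on is
bounded by the fixed point of the contraction from `L` on. -/
theorem le_of_le_mul_succ_add {μ c M : ℝ} {u : ℕ → ℝ} {L : ℕ} (hμ : 0 < μ) (hμ1 : μ < 1)
    (hM : ∀ n, u n ≤ M) (hu : ∀ n, L ≤ n → u n ≤ μ * u (n + 1) + (1 - μ) * c)
    {n : ℕ} (hn : L ≤ n) : u n ≤ c := by
  -- Looking `k` steps ahead shrinks the influence of the crude bound `M` by `μ ^ k`.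
  have key : ∀ k n, L ≤ n → u n ≤ c + μ ^ k * (M - c) := by
    intro k
    induction k with
    | zero => intro n _; simpa using hM n
    | succ k ih =>
      intro n hn
      have h1 := mul_le_mul_of_nonneg_left (ih (n + 1) (by omega)) hμ.le
      calc u n ≤ μ * u (n + 1) + (1 - μ) * c := hu n hn
        _ ≤ μ * (c + μ ^ k * (M - c)) + (1 - μ) * c := by linarith
        _ = c + μ ^ (k + 1) * (M - c) := by ring
  have hlim : Tendsto (fun k : ℕ => c + μ ^ k * (M - c)) atTop (𝓝 (c + 0 * (M - c))) :=
    ((tendsto_pow_atTop_nhds_zero_of_lt_one hμ.le hμ1).mul_const _).const_add _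
  simpa using ge_of_tendsto' hlim fun k => key k n hn

/-- A solution of the backward recurrence `y n = μ * y (n + 1) + (1 - μ) * b n` with
`0 ≤ b ≤ B` is bounded by `B`, or its absolute value tends to infinity. -/
theorem abs_le_or_tendsto_abs_atTop {μ B : ℝ} {b y : ℕ → ℝ} (hμ : 0 < μ) (hμ1 : μ < 1)
    (hb : ∀ n, 0 ≤ b n ∧ b n ≤ B) (hy : ∀ n, y n = μ * y (n + 1) + (1 - μ) * b n) :
    (∀ n, |y n| ≤ B) ∨ Tendsto (fun n => |y n|) atTop atTop := by
  rw [or_iff_not_imp_left]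
  intro h
  push Not at h
  obtain ⟨m, hm⟩ := h
  -- Once `|y|` exceeds `B`, its excess grows by a factor of at least `μ⁻¹` per step.
  have grow : ∀ k, |y m| - B ≤ μ ^ k * (|y (m + k)| - B) := by
    intro k
    induction k with
    | zero => simp
    | succ k ih =>
      have h1 : |y (m + k)| ≤ μ * |y (m + k + 1)| + (1 - μ) * B := by
        rw [hy (m + k)]
        refine (abs_add_le _ _).trans ?_
        rw [abs_mul, abs_mul, abs_of_pos hμ, abs_of_pos (sub_pos.2 hμ1),
          abs_of_nonneg (hb (m + k)).1]
        have := mul_le_mul_of_nonneg_left (hb (m + k)).2 (sub_pos.2 hμ1).le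
        linarith
      have h2 : |y (m + k)| - B ≤ μ * (|y (m + k + 1)| - B) := by linarith
      calc |y m| - B ≤ μ ^ k * (|y (m + k)| - B) := ih
        _ ≤ μ ^ k * (μ * (|y (m + k + 1)| - B)) :=
          mul_le_mul_of_nonneg_left h2 (pow_pos hμ k).le
        _ = μ ^ (k + 1) * (|y (m + (k + 1))| - B) := by rw [pow_succ, ← add_assoc]; ring
  have hlim : Tendsto (fun k : ℕ => B + (μ⁻¹) ^ k * (|y m| - B)) atTop atTop :=
    tendsto_atTop_add_const_left _ _
      ((tendsto_pow_atTop_atTop_of_one_lt ((one_lt_inv₀ hμ).2 hμ1)).atTop_mul_const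
        (sub_pos.2 hm))
  have hshift : Tendsto (fun k => |y (k + m)|) atTop atTop := by
    refine tendsto_atTop_mono (fun k => ?_) hlim
    have h3 : μ⁻¹ ^ k * (|y m| - B) ≤ |y (m + k)| - B := by
      rw [inv_pow, inv_mul_le_iff₀ (pow_pos hμ k)]
      exact grow k
    rw [add_comm k m]
    linarith
  exact (tendsto_add_atTop_iff_nat m).1 hshift

/-- For `μ < 1` a solution tends to zero, or its variation under every shift is controlled by
the variation of the carrying capacity. -/
theorem IsSolution.tendsto_zero_or_abs_sub_le {μ α β : ℝ} {K x : ℕ → ℝ} (hμ : 0 < μ)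
    (hμ1 : μ < 1) (hα : 0 < α) (hK : ∀ n, α ≤ K n ∧ K n ≤ β) (hx : IsSolution μ K x) :
    Tendsto x atTop (𝓝 0) ∨ ∀ (τ L : ℕ) (ε : ℝ), (∀ n, L ≤ n → |K (n + τ) - K n| ≤ ε) →
      ∀ n, L ≤ n → |x (n + τ) - x n| ≤ β ^ 2 / α ^ 2 * ε := by
  have hKpos : ∀ n, 0 < K n := fun n => hα.trans_le (hK n).1
  have hβ : 0 < β := (hKpos 0).trans_le (hK 0).2
  have h1μ : 0 < 1 - μ := sub_pos.2 hμ1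
  -- The zero solution has no reciprocal; otherwise `x` never vanishes.
  by_cases hx0 : x 0 = 0
  · left
    have hzero : ∀ n, x n = 0 := by
      intro n
      induction n with
      | zero => exact hx0
      | succ n ih => rw [(hx n).2, ih]; simp
    exact tendsto_const_nhds.congr fun n => (hzero n).symm
  have hne : ∀ n, x n ≠ 0 := by
    intro n
    induction n with
    | zero => exact hx0
    | succ n ih =>
      rw [(hx n).2]
      exact div_ne_zero (mul_ne_zero (mul_ne_zero hμ.ne' (hKpos n).ne') ih) (hx n).1
  have hrec : ∀ n, (x n)⁻¹ = μ * (x (n + 1))⁻¹ + (1 - μ) * (K n)⁻¹ := by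
    intro n
    rw [(hx n).2]
    have h1 := (hx n).1
    have h2 := hne n
    have h3 := (hKpos n).ne'
    field_simp
    ring
  have hinv : ∀ n, 0 ≤ (K n)⁻¹ ∧ (K n)⁻¹ ≤ α⁻¹ := fun n =>
    ⟨(inv_pos.2 (hKpos n)).le, inv_anti₀ hα (hK n).1⟩
  rcases abs_le_or_tendsto_abs_atTop hμ hμ1 hinv hrec with hbdd | htop
  swap
  · left
    rw [tendsto_zero_iff_abs_tendsto_zero]
    exact htop.inv_tendsto_atTop.congr fun n => by simp
  right
  have hlow : ∀ n, β⁻¹ ≤ (x n)⁻¹ := by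
    intro n
    -- Negation turns the upper-bound lemma into a lower bound, which also gives `x > 0`.
    have h := le_of_le_mul_succ_add (u := fun n => -(x n)⁻¹) (c := -β⁻¹) (M := α⁻¹) (L := 0)
      hμ hμ1 (fun n => (neg_le_abs _).trans (hbdd n)) (fun n _ => by
        have h1 := mul_le_mul_of_nonneg_left (inv_anti₀ (hKpos n) (hK n).2) h1μ.le
        have h2 := hrec n
        linarith) (Nat.zero_le n)
    exact neg_le_neg_iff.1 h
  have hxpos : ∀ n, 0 < x n := fun n => inv_pos.1 ((inv_pos.2 hβ).trans_le (hlow n))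
  have hxβ : ∀ n, x n ≤ β := fun n => (inv_le_inv₀ hβ (hxpos n)).1 (hlow n)
  intro τ L ε hε n hn
  have hKinv : ∀ n, L ≤ n → |(K (n + τ))⁻¹ - (K n)⁻¹| ≤ ε / α ^ 2 := by
    intro n hn
    have h0 : 0 < K (n + τ) * K n := mul_pos (hKpos _) (hKpos _)
    rw [inv_sub_inv (hKpos _).ne' (hKpos _).ne', abs_div, abs_sub_comm, abs_of_pos h0]
    refine div_le_div₀ ((abs_nonneg _).trans (hε n hn)) (hε n hn) (by positivity) ?_
    rw [sq]
    exact mul_le_mul (hK _).1 (hK _).1 hα.le (hKpos _).le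
  have hM : ∀ n, |(x (n + τ))⁻¹ - (x n)⁻¹| ≤ α⁻¹ + α⁻¹ := fun n =>
    (abs_sub _ _).trans (add_le_add (hbdd _) (hbdd _))
  have hdiff : ∀ n, (x (n + τ))⁻¹ - (x n)⁻¹ =
      μ * ((x (n + 1 + τ))⁻¹ - (x (n + 1))⁻¹) + (1 - μ) * ((K (n + τ))⁻¹ - (K n)⁻¹) := by
    intro n
    have h1 := hrec (n + τ)
    have h2 := hrec n
    rw [add_right_comm n τ 1] at h1
    linarith
  -- The bound at `n` involves only the forcing at times from `n` on, so `L` is preserved.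
  have hy : |(x (n + τ))⁻¹ - (x n)⁻¹| ≤ ε / α ^ 2 := by
    refine le_of_le_mul_succ_add (u := fun n => |(x (n + τ))⁻¹ - (x n)⁻¹|) hμ hμ1 hM
      (fun n hn => ?_) hn
    rw [hdiff n]
    refine (abs_add_le _ _).trans ?_
    rw [abs_mul, abs_mul, abs_of_pos hμ, abs_of_pos h1μ]
    have := mul_le_mul_of_nonneg_left (hKinv n hn) h1μ.le
    linarith
  have hxy : x (n + τ) - x n = -(x (n + τ) * x n * ((x (n + τ))⁻¹ - (x n)⁻¹)) := by
    have h1 := hne (n + τ)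
    have h2 := hne n
    field_simp
    ring
  rw [hxy, abs_neg, abs_mul, abs_of_pos (mul_pos (hxpos _) (hxpos _))]
  calc x (n + τ) * x n * |(x (n + τ))⁻¹ - (x n)⁻¹| ≤ β * β * (ε / α ^ 2) :=
        mul_le_mul (mul_le_mul (hxβ _) (hxβ _) (hxpos _).le hβ.le) hy (abs_nonneg _)
          (by positivity)
    _ = β ^ 2 / α ^ 2 * ε := by ring

/-- A convergent sequence is remotely stationary. -/
theorem remotelyStationary_of_tendsto {φ : ℕ → ℝ} {a : ℝ} (h : Tendsto φ atTop (𝓝 a)) :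
    RemotelyStationary φ := by
  intro τ
  simpa [RemotelyPeriodic] using (((tendsto_add_atTop_iff_nat τ).2 h).sub h).abs

/-- Puts periodicity in the form used for almost periodicity, so one transfer estimate serves both.
-/
theorem remotelyPeriodic_iff {τ : ℕ} {φ : ℕ → ℝ} :
    RemotelyPeriodic τ φ ↔ ∀ ε : ℝ, 0 < ε → ∃ L : ℕ, 0 < L ∧
      ∀ n : ℕ, L ≤ n → |φ (n + τ) - φ n| < ε := by
  simp only [RemotelyPeriodic, Metric.tendsto_atTop, Real.dist_eq, sub_zero, abs_abs]
  refine forall₂_congr fun ε _ => ⟨?_, ?_⟩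
  · rintro ⟨L, hL⟩
    exact ⟨L + 1, L.succ_pos, fun n hn => hL n (by omega)⟩
  · rintro ⟨L, -, hL⟩
    exact ⟨L, hL⟩

theorem relativelyDense_univ : RelativelyDense Set.univ :=
  ⟨1, one_pos, fun a => ⟨a, by simp⟩⟩

/-- A remotely stationary sequence is remotely almost periodic. -/
theorem RemotelyStationary.remotelyAlmostPeriodic {φ : ℕ → ℝ} (h : RemotelyStationary φ) :
    RemotelyAlmostPeriodic φ := fun ε hε =>
  ⟨Set.univ, relativelyDense_univ, fun τ _ => remotelyPeriodic_iff.1 (h τ) ε hε⟩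

end BevertonHolt

theorem mainTheorem7 (μ α β : ℝ) (K : ℕ → ℝ) (hμ : 0 < μ) (hα : 0 < α) (hαβ : α < β)
    (hK : ∀ n : ℕ, α ≤ K n ∧ K n ≤ β) (hμαβ : μ * β ^ 2 / α ^ 2 ≤ 1) :
    (BevertonHolt.RemotelyStationary K →
      ∀ x : ℕ → ℝ, BevertonHolt.IsSolution μ K x → BevertonHolt.RemotelyStationary x) ∧
    (∀ τ : ℕ, 0 < τ → BevertonHolt.RemotelyPeriodic τ K →
      ∀ x : ℕ → ℝ, BevertonHolt.IsSolution μ K x → BevertonHolt.RemotelyPeriodic τ x) ∧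
    (BevertonHolt.RemotelyAlmostPeriodic K →
      ∀ x : ℕ → ℝ, BevertonHolt.IsSolution μ K x → BevertonHolt.RemotelyAlmostPeriodic x) := by
  have hβ : 0 < β := hα.trans hαβ
  have hsq : α ^ 2 < β ^ 2 := pow_lt_pow_left₀ hαβ hα.le two_ne_zero
  -- Strictness comes from `α < β`: `μ ≥ 1` would give `β ^ 2 ≤ μ * β ^ 2 ≤ α ^ 2`.
  have hμ1 : μ < 1 := by
    rw [div_le_one (by positivity)] at hμαβ
    by_contra! h
    have := mul_le_mul_of_nonneg_right h (sq_nonneg β)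
    linarith
  set C : ℝ := β ^ 2 / α ^ 2 with hC
  have hCpos : 0 < C := by positivity
  -- The factor 2 in `ε / (2 * C)` restores a strict inequality after the non-strict estimate.
  have transfer : ∀ x : ℕ → ℝ, BevertonHolt.IsSolution μ K x →
      BevertonHolt.RemotelyStationary x ∨ ∀ (τ L : ℕ) (ε : ℝ), 0 < ε →
        (∀ n, L ≤ n → |K (n + τ) - K n| < ε / (2 * C)) →
        ∀ n, L ≤ n → |x (n + τ) - x n| < ε := by
    intro x hx
    refine (hx.tendsto_zero_or_abs_sub_le hμ hμ1 hα hK).imp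
      BevertonHolt.remotelyStationary_of_tendsto fun h τ L ε hε hL n hn => ?_
    refine (h τ L _ (fun n hn => (hL n hn).le) n hn).trans_lt ?_
    rw [← hC, show C * (ε / (2 * C)) = ε / 2 by field_simp]
    exact half_lt_self hε
  have periodic : ∀ τ : ℕ, BevertonHolt.RemotelyPeriodic τ K →
      ∀ x : ℕ → ℝ, BevertonHolt.IsSolution μ K x → BevertonHolt.RemotelyPeriodic τ x := by
    intro τ hτ x hx
    rcases transfer x hx with h | h
    · exact h τ
    · refine BevertonHolt.remotelyPeriodic_iff.2 fun ε hε => ?_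
      obtain ⟨L, hL0, hL⟩ :=
        BevertonHolt.remotelyPeriodic_iff.1 hτ (ε / (2 * C)) (by positivity)
      exact ⟨L, hL0, h τ L ε hε hL⟩
  refine ⟨fun hst x hx τ => periodic τ (hst τ) x hx, fun τ _ => periodic τ, fun hap x hx => ?_⟩
  rcases transfer x hx with h | h
  · exact h.remotelyAlmostPeriodic
  · intro ε hε
    obtain ⟨P, hP, hPL⟩ := hap (ε / (2 * C)) (by positivity)
    refine ⟨P, hP, fun τ hτ => ?_⟩
    obtain ⟨L, hL0, hL⟩ := hPL τ hτ
    exact ⟨L, hL0, h τ L ε hε hL⟩
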